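/- Let $\Bbbk$ be a commutative ring; all categories and functors are $\Bbbk$-linear. Let $\mathcal C$ be a category and let $S\colon\mathcal C\to\mathcal C$ be an auto-equivalence. The *colimit orbit category* $\mathcal C_{/S}$ is the $\mathbb Z$-graded category with the same objects as $\mathcal C$ and $$\mathcal C_{/S}(X,Y)=\bigoplus_{r\in\mathbb Z}\mathcal C^r_{/S}(X,Y),\qquad \mathcal C^r_{/S}(X,Y)=\varinjlim_{m\ge\max(0,r)}\mathcal C(S^{m-r}X,S^mY),$$ where the transition maps are induced by $S$. The classes of $f\colon S^{a}X\to S^{b}Y$ and $g\colon S^{c}Y\to S^{d}Z$ have as composite the class of $S^b(g)\circ S^c(f)\colon S^{a+c}X\to S^{b+d}Z$, and this is extended bilinearly. For a $\mathbb Z$-graded category $\mathcal B$, the *smash product* $\mathcal B\#\mathbb Z$ has objects $x^{(i)}$ ($x\in\mathcal B$, $i\in\mathbb Z$), morphisms $(\mathcal B\#\mathbb Z)(x^{(i)},y^{(j)})=\mathcal B^{\,i-j}(x,y)$, and the composition of $\mathcal B$. Let $S'$ be the automorphism of $\mathcal C_{/S}\#\mathbb Z$ given by $X^{(i)}\mapsto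 X^{(i-1)}$ and by the identity on morphisms. Let $H\colon\mathcal C\to\mathcal C_{/S}\#\mathbb Z$ be the functor $X\mapsto X^{(0)}$, $f\mapsto[f]$. For a group $G$ acting on a category $\mathcal D$ by automorphisms, the *orbit category* $\mathcal D/G$ has the objects of $\mathcal D$. Its morphisms $x\to y$ are the row-finite and column-finite families $(f_{\beta,\alpha}\colon\alpha x\to\beta y)_{\alpha,\beta\in G}$ with $f_{\gamma\beta,\gamma\alpha}=\gamma(f_{\beta,\alpha})$ for all $\alpha,\beta,\gamma\in G$, and they are composed by matrix multiplication. Put $\mathcal C/\langle\bar S\rangle:=(\mathcal C_{/S}\#\mathbb Z)/\langle S'\rangle$, where $\langle S'\rangle$ is the cyclic group of automorphisms generated by $S'$. **Theorem.** 1. $H$ is an equivalence of $\Bbbk$-linear categories. 2. There is a natural isomorphism $H\circ S\cong S'\circ H$. 3. There is an equivalence of $\Bbbk$-linear categories $\mathcal C/\langle\bar S\rangle\simeq\mathcal C_{/S}$. -/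

import Mathlib

open CategoryTheory

noncomputable section

namespace ColimitOrbit

universe w u v

/-! ### Groups acting on linear categories by automorphisms, and orbit categories -/

/-- Strict automorphisms of a `k`-linear category `D`: `k`-linear functors `D ⥤ D` with a
two-sided inverse on the nose. (The inverse of a `k`-linear automorphism is automatically
`k`-linear.) -/
@[ext]
structure LinAut (k : Type w) [CommRing k] (D : Type u) [Category.{v} D] [Preadditive D]
    [Linear k D] where
  functor : D ⥤ D
  inverse : D ⥤ D
  functor_inverse : functor ⋙ inverse = 𝟭 D
  inverse_functor : inverse ⋙ functor = 𝟭 D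
  functor_additive : functor.Additive
  functor_linear : functor.Linear k
  inverse_additive : inverse.Additive
  inverse_linear : inverse.Linear k

section LinAut

variable {k : Type w} [CommRing k] {D : Type u} [Category.{v} D] [Preadditive D] [Linear k D]

attribute [instance] LinAut.functor_additive LinAut.functor_linear
  LinAut.inverse_additive LinAut.inverse_linear

/-- `f * g` is the composite "first `g`, then `f`". -/
instance : Mul (LinAut k D) where
  mul f g :=
    { functor := g.functor ⋙ f.functor
      inverse := f.inverse ⋙ g.inverse
      functor_inverse := by
        have h : (g.functor ⋙ f.functor) ⋙ f.inverse ⋙ g.inverse =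
          g.functor ⋙ (f.functor ⋙ f.inverse) ⋙ g.inverse := rfl
        rw [h, f.functor_inverse]
        exact g.functor_inverse
      inverse_functor := by
        have h : (f.inverse ⋙ g.inverse) ⋙ g.functor ⋙ f.functor =
          f.inverse ⋙ (g.inverse ⋙ g.functor) ⋙ f.functor := rfl
        rw [h, g.inverse_functor]
        exact f.inverse_functor
      functor_additive := inferInstance
      functor_linear := inferInstance
      inverse_additive := inferInstance
      inverse_linear := inferInstance }

instance : One (LinAut k D) where
  one :=
    { functor := 𝟭 D
      inverse := 𝟭 D
      functor_inverse := rfl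
      inverse_functor := rfl
      functor_additive := inferInstance
      functor_linear := inferInstance
      inverse_additive := inferInstance
      inverse_linear := inferInstance }

instance : Inv (LinAut k D) where
  inv f :=
    { functor := f.inverse
      inverse := f.functor
      functor_inverse := f.inverse_functor
      inverse_functor := f.functor_inverse
      functor_additive := inferInstance
      functor_linear := inferInstance
      inverse_additive := inferInstance
      inverse_linear := inferInstance }

lemma LinAut.mul_functor (f g : LinAut k D) : (f * g).functor = g.functor ⋙ f.functor := rfl

instance : Group (LinAut k D) where
  mul_assoc _ _ _ := rfl
  one_mul _ := rfl
  mul_one _ := rfl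
  inv_mul_cancel f := LinAut.ext f.functor_inverse f.functor_inverse

end LinAut

section Orbit

variable {k : Type w} [CommRing k] {D : Type u} [Category.{v} D] [Preadditive D] [Linear k D]
variable {G : Type*} [Group G]

lemma act_mul_obj (ρ : G →* LinAut k D) (γ α : G) (x : D) :
    (ρ (γ * α)).functor.obj x = (ρ γ).functor.obj ((ρ α).functor.obj x) := by
  rw [map_mul]; rfl

/-- For `f : α x ⟶ β y`, the morphism `γ f : (γ α) x ⟶ (γ β) y`
(`eqToHom` only identifies `(γ α) x` with `γ (α x)`). -/
def actMap (ρ : G →* LinAut k D) (γ : G) {α β : G} {x y : D}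
    (f : (ρ α).functor.obj x ⟶ (ρ β).functor.obj y) :
    (ρ (γ * α)).functor.obj x ⟶ (ρ (γ * β)).functor.obj y :=
  eqToHom (act_mul_obj ρ γ α x) ≫ (ρ γ).functor.map f ≫ eqToHom (act_mul_obj ρ γ β y).symm

/-- The orbit category `D/G` has the same objects as `D`. -/
structure OrbitCat (ρ : G →* LinAut k D) where
  obj : D

/-- Morphisms `x ⟶ y` of `D/G`: matrices `f β α : α x ⟶ β y` (`α, β ∈ G`) that are row finite and
column finite and are `G`-invariant, i.e. `f (γ β) (γ α) = γ (f β α)`. -/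
def orbitHom (ρ : G →* LinAut k D) (x y : D) :
    Submodule k (∀ β α : G, (ρ α).functor.obj x ⟶ (ρ β).functor.obj y) where
  carrier := {f | (∀ α, {β | f β α ≠ 0}.Finite) ∧ (∀ β, {α | f β α ≠ 0}.Finite) ∧
    ∀ γ β α, f (γ * β) (γ * α) = actMap ρ γ (f β α)}
  add_mem' := by
    rintro f g ⟨hf1, hf2, hf3⟩ ⟨hg1, hg2, hg3⟩
    refine ⟨fun α => ((hf1 α).union (hg1 α)).subset ?_,
      fun β => ((hf2 β).union (hg2 β)).subset ?_, fun γ β α => ?_⟩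
    · intro β hβ
      by_contra h
      simp only [Set.mem_union, Set.mem_ofPred_eq, not_or, not_not] at h
      exact hβ (by simp [h.1, h.2])
    · intro α hα
      by_contra h
      simp only [Set.mem_union, Set.mem_ofPred_eq, not_or, not_not] at h
      exact hα (by simp [h.1, h.2])
    · simp [hf3, hg3, actMap]
  zero_mem' := by
    refine ⟨fun α => by simp, fun β => by simp, fun γ β α => by simp [actMap]⟩
  smul_mem' := by
    rintro c f ⟨hf1, hf2, hf3⟩
    refine ⟨fun α => (hf1 α).subset ?_, fun β => (hf2 β).subset ?_, fun γ β α => ?_⟩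
    · intro β hβ h
      exact hβ (by simp [h])
    · intro α hα h
      exact hα (by simp [h])
    · simp [hf3, actMap]

/-- The matrix product `(g f) β α = ∑_γ (g β γ) ∘ (f γ α)`, a sum with finitely many nonzero
terms. -/
def orbitCompFun (ρ : G →* LinAut k D) {x y z : D}
    (f : ∀ β α : G, (ρ α).functor.obj x ⟶ (ρ β).functor.obj y)
    (g : ∀ β α : G, (ρ α).functor.obj y ⟶ (ρ β).functor.obj z) :
    ∀ β α : G, (ρ α).functor.obj x ⟶ (ρ β).functor.obj z :=
  fun β α => ∑ᶠ γ : G, f γ α ≫ g β γ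

lemma orbitCompFun_col (ρ : G →* LinAut k D) {x y z : D} {f : orbitHom ρ x y}
    {g : orbitHom ρ y z} (β α : G) (s : Finset G) (hs : ∀ γ, f.1 γ α ≠ 0 → γ ∈ s) :
    orbitCompFun ρ f.1 g.1 β α = ∑ γ ∈ s, f.1 γ α ≫ g.1 β γ := by
  refine finsum_eq_sum_of_support_subset _ fun γ hγ => hs γ fun h => hγ ?_
  simp [h]

lemma orbitCompFun_row (ρ : G →* LinAut k D) {x y z : D} {f : orbitHom ρ x y}
    {g : orbitHom ρ y z} (β α : G) (s : Finset G) (hs : ∀ γ, g.1 β γ ≠ 0 → γ ∈ s) :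
    orbitCompFun ρ f.1 g.1 β α = ∑ γ ∈ s, f.1 γ α ≫ g.1 β γ := by
  refine finsum_eq_sum_of_support_subset _ fun γ hγ => hs γ fun h => hγ ?_
  simp [h]

lemma actMap_comp (ρ : G →* LinAut k D) (γ : G) {α β δ : G} {x y z : D}
    (f : (ρ α).functor.obj x ⟶ (ρ β).functor.obj y)
    (g : (ρ β).functor.obj y ⟶ (ρ δ).functor.obj z) :
    actMap ρ γ (f ≫ g) = actMap ρ γ f ≫ actMap ρ γ g := by
  simp [actMap]

lemma actMap_sum (ρ : G →* LinAut k D) (γ : G) {α β : G} {x y : D} {ι : Type*} (s : Finset ι)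
    (f : ι → ((ρ α).functor.obj x ⟶ (ρ β).functor.obj y)) :
    actMap ρ γ (∑ i ∈ s, f i) = ∑ i ∈ s, actMap ρ γ (f i) := by
  simp [actMap, Functor.map_sum, Preadditive.sum_comp, Preadditive.comp_sum]

lemma orbitCompFun_mem (ρ : G →* LinAut k D) {x y z : D} (f : orbitHom ρ x y)
    (g : orbitHom ρ y z) : orbitCompFun ρ f.1 g.1 ∈ orbitHom ρ x z := by
  refine ⟨fun α => ?_, fun β => ?_, fun γ β α => ?_⟩
  · refine ((f.2.1 α).biUnion fun γ _ => g.2.1 γ).subset fun β hβ => ?_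
    by_contra h
    refine hβ ?_
    rw [orbitCompFun_col ρ β α (f.2.1 α).toFinset (by simp)]
    refine Finset.sum_eq_zero fun γ hγ => ?_
    simp only [Set.mem_iUnion, not_exists, Set.mem_ofPred_eq, not_not] at h
    rw [h γ (by simpa using hγ), Limits.comp_zero]
  · refine ((g.2.2.1 β).biUnion fun γ _ => f.2.2.1 γ).subset fun α hα => ?_
    by_contra h
    refine hα ?_
    rw [orbitCompFun_row ρ β α (g.2.2.1 β).toFinset (by simp)]
    refine Finset.sum_eq_zero fun γ hγ => ?_
    simp only [Set.mem_iUnion, not_exists, Set.mem_ofPred_eq, not_not] at h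
    rw [h γ (by simpa using hγ), Limits.zero_comp]
  · classical
    rw [orbitCompFun_col ρ β α (f.2.1 α).toFinset (by simp), actMap_sum,
      orbitCompFun_col ρ (γ * β) (γ * α) ((f.2.1 α).toFinset.image (γ * ·)) ?_,
      Finset.sum_image (by simp)]
    · refine Finset.sum_congr rfl fun δ _ => ?_
      rw [actMap_comp, f.2.2.2, g.2.2.2]
    · intro δ hδ
      refine Finset.mem_image.2 ⟨γ⁻¹ * δ, ?_, by simp⟩
      simp only [Set.Finite.mem_toFinset, Set.mem_ofPred_eq]
      intro h
      have h0 : f.1 (γ * (γ⁻¹ * δ)) (γ * α) = 0 := by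
        rw [f.2.2.2, h]
        simp [actMap]
      rw [mul_inv_cancel_left] at h0
      exact hδ h0

/-- The identity matrix. -/
def orbitId (ρ : G →* LinAut k D) (x : D) : orbitHom ρ x x := by
  classical
  refine ⟨fun β α => if h : α = β then eqToHom (by rw [h]) else 0, fun α => ?_, fun β => ?_,
    fun γ β α => ?_⟩
  · refine (Set.finite_singleton α).subset fun β hβ => ?_
    by_contra h
    exact hβ (dif_neg fun e => h e.symm)
  · refine (Set.finite_singleton β).subset fun α hα => ?_
    by_contra h
    exact hα (dif_neg h)
  · by_cases h : α = β
    · subst h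
      simp [actMap]
    · simp [actMap, h]

lemma orbitId_same (ρ : G →* LinAut k D) (x : D) (α : G) : (orbitId ρ x).1 α α = 𝟙 _ := by
  simp [orbitId]

lemma orbitId_ne (ρ : G →* LinAut k D) (x : D) (β α : G) (h : α ≠ β) :
    (orbitId ρ x).1 β α = 0 := by
  simp [orbitId, h]

/-- The orbit category `D/G`. -/
instance (ρ : G →* LinAut k D) : Category (OrbitCat ρ) where
  Hom x y := orbitHom ρ x.obj y.obj
  id x := orbitId ρ x.obj
  comp f g := ⟨orbitCompFun ρ f.1 g.1, orbitCompFun_mem ρ f g⟩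
  id_comp {x y} f := by
    refine Subtype.ext (funext fun β => funext fun α => ?_)
    refine (orbitCompFun_col ρ β α {α} fun γ hγ => ?_).trans ?_
    · by_contra h
      exact hγ (orbitId_ne ρ _ _ _ fun e => h (by simp [e]))
    · rw [Finset.sum_singleton, orbitId_same]
      exact Category.id_comp _
  comp_id {x y} f := by
    refine Subtype.ext (funext fun β => funext fun α => ?_)
    refine (orbitCompFun_row ρ β α {β} fun γ hγ => ?_).trans ?_
    · by_contra h
      exact hγ (orbitId_ne ρ _ _ _ fun e => h (by simp [e]))
    · rw [Finset.sum_singleton, orbitId_same]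
      exact Category.comp_id _
  assoc {x y z t} f g h := by
    refine Subtype.ext (funext fun β => funext fun α => ?_)
    refine (orbitCompFun_row ρ (f := ⟨_, orbitCompFun_mem ρ f g⟩) (g := h) β α
      (h.2.2.1 β).toFinset (by simp)).trans (Eq.trans ?_ (orbitCompFun_col ρ (f := f)
      (g := ⟨_, orbitCompFun_mem ρ g h⟩) β α (f.2.1 α).toFinset (by simp)).symm)
    have h1 : ∀ γ, orbitCompFun ρ f.1 g.1 γ α =
        ∑ δ ∈ (f.2.1 α).toFinset, f.1 δ α ≫ g.1 γ δ := fun γ =>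
      orbitCompFun_col ρ γ α _ (by simp)
    have h2 : ∀ δ, orbitCompFun ρ g.1 h.1 β δ =
        ∑ γ ∈ (h.2.2.1 β).toFinset, g.1 γ δ ≫ h.1 β γ := fun δ =>
      orbitCompFun_row ρ β δ _ (by simp)
    simp only [h1, h2, Preadditive.sum_comp, Preadditive.comp_sum, Category.assoc]
    exact Finset.sum_comm

lemma orbit_comp_apply {ρ : G →* LinAut k D} {x y z : OrbitCat ρ} (f : x ⟶ y) (g : y ⟶ z)
    (β α : G) : (f ≫ g).1 β α = ∑ᶠ γ : G, f.1 γ α ≫ g.1 β γ := rfl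

instance (ρ : G →* LinAut k D) : Preadditive (OrbitCat ρ) where
  homGroup x y := inferInstanceAs (AddCommGroup (orbitHom ρ x.obj y.obj))
  add_comp := fun x y z (f f' : orbitHom ρ x.obj y.obj) (g : orbitHom ρ y.obj z.obj) => by
    refine Subtype.ext (funext fun β => funext fun α => ?_)
    refine (orbitCompFun_row ρ (f := f + f') (g := g) β α (g.2.2.1 β).toFinset
      (by simp)).trans ?_
    refine Eq.trans ?_ (congrArg₂ (· + ·)
      (orbitCompFun_row ρ (f := f) (g := g) β α (g.2.2.1 β).toFinset (by simp))
      (orbitCompFun_row ρ (f := f') (g := g) β α (g.2.2.1 β).toFinset (by simp))).symm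
    refine Eq.trans ?_ Finset.sum_add_distrib
    exact Finset.sum_congr rfl fun γ _ => Preadditive.add_comp _ _ _ (f.1 γ α) (f'.1 γ α) _
  comp_add := fun x y z (f : orbitHom ρ x.obj y.obj) (g g' : orbitHom ρ y.obj z.obj) => by
    refine Subtype.ext (funext fun β => funext fun α => ?_)
    refine (orbitCompFun_col ρ (f := f) (g := g + g') β α (f.2.1 α).toFinset
      (by simp)).trans ?_
    refine Eq.trans ?_ (congrArg₂ (· + ·)
      (orbitCompFun_col ρ (f := f) (g := g) β α (f.2.1 α).toFinset (by simp))
      (orbitCompFun_col ρ (f := f) (g := g') β α (f.2.1 α).toFinset (by simp))).symm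
    refine Eq.trans ?_ Finset.sum_add_distrib
    exact Finset.sum_congr rfl fun γ _ => Preadditive.comp_add _ _ _ _ (g.1 β γ) (g'.1 β γ)

instance (ρ : G →* LinAut k D) : Linear k (OrbitCat ρ) where
  homModule x y := inferInstanceAs (Module k (orbitHom ρ x.obj y.obj))
  smul_comp := fun x y z r (f : orbitHom ρ x.obj y.obj) (g : orbitHom ρ y.obj z.obj) => by
    refine Subtype.ext (funext fun β => funext fun α => ?_)
    refine (orbitCompFun_row ρ (f := r • f) (g := g) β α (g.2.2.1 β).toFinset
      (by simp)).trans ?_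
    refine Eq.trans ?_ (congrArg (r • ·)
      (orbitCompFun_row ρ (f := f) (g := g) β α (g.2.2.1 β).toFinset (by simp))).symm
    refine Eq.trans ?_ Finset.smul_sum.symm
    exact Finset.sum_congr rfl fun γ _ => Linear.smul_comp _ _ _ r (f.1 γ α) _
  comp_smul := fun x y z (f : orbitHom ρ x.obj y.obj) r (g : orbitHom ρ y.obj z.obj) => by
    refine Subtype.ext (funext fun β => funext fun α => ?_)
    refine (orbitCompFun_col ρ (f := f) (g := r • g) β α (f.2.1 α).toFinset
      (by simp)).trans ?_
    refine Eq.trans ?_ (congrArg (r • ·)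
      (orbitCompFun_col ρ (f := f) (g := g) β α (f.2.1 α).toFinset (by simp))).symm
    refine Eq.trans ?_ Finset.smul_sum.symm
    exact Finset.sum_congr rfl fun γ _ => Linear.comp_smul _ _ _ _ r (g.1 β γ)

/-- The orbit category `D/⟨T⟩` by the cyclic group `⟨T⟩` generated by an automorphism `T`, acting
tautologically on `D`. -/
abbrev OrbitByAut (T : LinAut k D) := OrbitCat (Subgroup.zpowers T).subtype

end Orbit

/-! ### Graded categories and smash products with `ℤ` -/

/-- A `ℤ`-grading of a `k`-linear category: direct sum decompositions of the Hom-modules that are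
compatible with composition. (For a grading by a group, `id_mem` follows from the other axioms.) -/
class ZGraded (k : Type w) [CommRing k] (B : Type u) [Category.{v} B] [Preadditive B]
    [Linear k B] where
  piece : ℤ → ∀ x y : B, Submodule k (x ⟶ y)
  isInternal : ∀ x y : B, DirectSum.IsInternal fun r => piece r x y
  id_mem : ∀ x : B, 𝟙 x ∈ piece 0 x x
  comp_mem : ∀ {r s : ℤ} {x y z : B} {f : x ⟶ y} {g : y ⟶ z},
    f ∈ piece r x y → g ∈ piece s y z → f ≫ g ∈ piece (s + r) x z

section Smash

/-- Objects `x^(i)` of the smash product `B # ℤ`. -/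
@[ext]
structure Smash (k : Type w) [CommRing k] (B : Type u) [Category.{v} B] [Preadditive B]
    [Linear k B] [ZGraded k B] where
  obj : B
  deg : ℤ

variable {k : Type w} [CommRing k] {B : Type u} [Category.{v} B] [Preadditive B]
  [Linear k B] [ZGraded k B]

/-- The smash product: `(B # ℤ)(x^(i), y^(j)) = B^(i - j)(x, y)`, with the composition of `B`. -/
instance : Category (Smash k B) where
  Hom x y := ZGraded.piece (k := k) (x.deg - y.deg) x.obj y.obj
  id x := ⟨𝟙 x.obj, by rw [sub_self]; exact ZGraded.id_mem _⟩
  comp {x y z} f g := ⟨f.1 ≫ g.1, by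
    have h := ZGraded.comp_mem f.2 g.2
    rwa [sub_add_sub_comm, add_comm y.deg, add_sub_add_right_eq_sub] at h⟩
  id_comp f := Subtype.ext (Category.id_comp f.1)
  comp_id f := Subtype.ext (Category.comp_id f.1)
  assoc f g h := Subtype.ext (Category.assoc f.1 g.1 h.1)

instance : Preadditive (Smash k B) where
  homGroup x y :=
    inferInstanceAs (AddCommGroup (ZGraded.piece (k := k) (x.deg - y.deg) x.obj y.obj))
  add_comp _ _ _ f f' g := Subtype.ext (Preadditive.add_comp _ _ _ f.1 f'.1 g.1)
  comp_add _ _ _ f g g' := Subtype.ext (Preadditive.comp_add _ _ _ f.1 g.1 g'.1)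

instance : Linear k (Smash k B) where
  homModule x y := inferInstanceAs (Module k (ZGraded.piece (x.deg - y.deg) x.obj y.obj))
  smul_comp _ _ _ r f g := Subtype.ext (Linear.smul_comp _ _ _ r f.1 g.1)
  comp_smul _ _ _ f r g := Subtype.ext (Linear.comp_smul _ _ _ f.1 r g.1)

variable (k B)

/-- Translation `x^(i) ↦ x^(i + n)`, the identity on the underlying morphisms of `B`. -/
def translate (n : ℤ) : Smash k B ⥤ Smash k B where
  obj x := ⟨x.obj, x.deg + n⟩
  map {x y} f := ⟨f.1, by
    have h : f.1 ∈ ZGraded.piece (k := k) (x.deg - y.deg) x.obj y.obj := f.2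
    change _ ∈ ZGraded.piece (k := k) ((x.deg + n) - (y.deg + n)) x.obj y.obj
    rw [add_sub_add_right_eq_sub]
    exact h⟩

instance (n : ℤ) : (translate k B n).Additive where
  map_add := rfl

instance (n : ℤ) : (translate k B n).Linear k where
  map_smul _ _ := rfl

lemma smash_hom_heq {x y x' y' : Smash k B} (hx : x = x') (hy : y = y') {f : x ⟶ y}
    {f' : x' ⟶ y'} (h : HEq f.1 f'.1) : HEq f f' := by
  subst hx hy
  exact heq_of_eq (Subtype.ext (eq_of_heq h))

lemma translate_comp (m n : ℤ) (h : m + n = 0) :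
    translate k B m ⋙ translate k B n = 𝟭 (Smash k B) := by
  have ho : ∀ x, (translate k B m ⋙ translate k B n).obj x = x := fun x => by
    ext
    · rfl
    · change x.deg + m + n = x.deg
      rw [add_assoc, h, add_zero]
  exact CategoryTheory.Functor.hext ho fun x y f =>
    smash_hom_heq k B (ho x) (ho y) HEq.rfl

/-- The automorphism `S'` of `B # ℤ`: `x^(i) ↦ x^(i - 1)`, the identity on morphisms. -/
def smashShift : LinAut k (Smash k B) where
  functor := translate k B (-1)
  inverse := translate k B 1
  functor_inverse := translate_comp k B _ _ (by simp)
  inverse_functor := translate_comp k B _ _ (by simp)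
  functor_additive := inferInstance
  functor_linear := inferInstance
  inverse_additive := inferInstance
  inverse_linear := inferInstance

end Smash

/-! ### The colimit orbit category -/

section Colim

variable {k : Type w} [CommRing k] {C : Type u} [Category.{v} C] [Preadditive C] [Linear k C]

/-- `S^n X`. -/
def iterObj (S : C ⥤ C) (X : C) : ℕ → C
  | 0 => X
  | n + 1 => S.obj (iterObj S X n)

variable (k) (S : C ⥤ C) [S.Additive] [S.Linear k]

/-- `f ↦ S^n f`, from `C(S^a X, S^b Y)` to `C(S^(a+n) X, S^(b+n) Y)`. -/
def iterMap (X Y : C) (a b : ℕ) : ∀ n : ℕ,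
    (iterObj S X a ⟶ iterObj S Y b) →ₗ[k] (iterObj S X (a + n) ⟶ iterObj S Y (b + n))
  | 0 => LinearMap.id
  | n + 1 => (S.mapLinearMap k).comp (iterMap X Y a b n)

/-- The same map with target `C(S^a' X, S^b' Y)`, where `a' = a + n` and `b' = b + n`. -/
def iterMap' {X Y : C} {a b a' b' : ℕ} (n : ℕ) (ha : a' = a + n) (hb : b' = b + n) :
    (iterObj S X a ⟶ iterObj S Y b) →ₗ[k] (iterObj S X a' ⟶ iterObj S Y b') :=
  ha ▸ hb ▸ iterMap k S X Y a b n

/-- The index set of the colimit in degree `r`: a pair `(a, b) = (m - r, m)` of natural numbers,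
for `m ≥ r`, `m ≥ 0`, ordered by `m`. -/
abbrev Idx (r : ℤ) := {p : ℕ × ℕ // (p.1 : ℤ) + r = p.2}

lemma Idx.snd_eq {r : ℤ} {p q : Idx r} (h : p ≤ q) : q.1.2 = p.1.2 + (q.1.1 - p.1.1) := by
  have h1 : p.1.1 ≤ q.1.1 := h.1
  have := p.2
  have := q.2
  omega

lemma Idx.fst_eq {r : ℤ} {p q : Idx r} (h : p ≤ q) : q.1.1 = p.1.1 + (q.1.1 - p.1.1) := by
  have h1 : p.1.1 ≤ q.1.1 := h.1
  omega

/-- The transition maps `C(S^(m-r) X, S^m Y) → C(S^(m'-r) X, S^m' Y)`, `f ↦ S^(m'-m) f`. -/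
def transition (r : ℤ) (X Y : C) (p q : Idx r) (h : p ≤ q) :
    (iterObj S X p.1.1 ⟶ iterObj S Y p.1.2) →ₗ[k] (iterObj S X q.1.1 ⟶ iterObj S Y q.1.2) :=
  iterMap' k S (q.1.1 - p.1.1) (Idx.fst_eq h) (Idx.snd_eq h)

/-- `C_{/S}^r(X, Y) = colim_{m ≥ r} C(S^(m-r) X, S^m Y)`. -/
abbrev ColimHom (r : ℤ) (X Y : C) : Type v :=
  Module.DirectLimit (fun p : Idx r => (iterObj S X p.1.1 ⟶ iterObj S Y p.1.2))
    (transition k S r X Y)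

variable {k S}

/-- The class `[f]` in the colimit. -/
def colimMk {r : ℤ} {X Y : C} {a b : ℕ} (h : (a : ℤ) + r = b) :
    (iterObj S X a ⟶ iterObj S Y b) →ₗ[k] ColimHom k S r X Y :=
  Module.DirectLimit.of k (Idx r) (fun p : Idx r => (iterObj S X p.1.1 ⟶ iterObj S Y p.1.2))
    (transition k S r X Y) ⟨(a, b), h⟩

lemma iterMap'_comp {X Y Z : C} {a b c a' b' c' : ℕ} (n : ℕ) (ha : a' = a + n) (hb : b' = b + n)
    (hc : c' = c + n) (f : iterObj S X a ⟶ iterObj S Y b) (g : iterObj S Y b ⟶ iterObj S Z c) :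
    iterMap' k S n ha hc (f ≫ g) = iterMap' k S n ha hb f ≫ iterMap' k S n hb hc g := by
  subst ha hb hc
  change iterMap k S X Z a c n (f ≫ g) = iterMap k S X Y a b n f ≫ iterMap k S Y Z b c n g
  induction n with
  | zero => rfl
  | succ n ih =>
    change S.map (iterMap k S X Z a c n (f ≫ g)) =
      S.map (iterMap k S X Y a b n f) ≫ S.map (iterMap k S Y Z b c n g)
    rw [ih, S.map_comp]

lemma iterMap'_id {X : C} {a a' : ℕ} (n : ℕ) (ha : a' = a + n) :
    iterMap' k S n ha ha (𝟙 (iterObj S X a)) = 𝟙 _ := by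
  subst ha
  change iterMap k S X X a a n _ = _
  induction n with
  | zero => rfl
  | succ n ih =>
    change S.map (iterMap k S X X a a n _) = 𝟙 (S.obj _)
    rw [ih, S.map_id]

lemma iterMap'_succ {X Y : C} {a b a' b' : ℕ} (n : ℕ) (ha : a' = a + n) (hb : b' = b + n)
    (ha' : a' + 1 = a + (n + 1)) (hb' : b' + 1 = b + (n + 1))
    (f : iterObj S X a ⟶ iterObj S Y b) :
    iterMap' k S (n + 1) ha' hb' f = S.map (iterMap' k S n ha hb f) := by
  subst ha hb
  rfl

lemma iterMap'_iterMap' {X Y : C} {a b a' b' a'' b'' : ℕ} (n m l : ℕ) (ha : a' = a + n)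
    (hb : b' = b + n) (ha' : a'' = a' + m) (hb' : b'' = b' + m) (ha'' : a'' = a + l)
    (hb'' : b'' = b + l) (f : iterObj S X a ⟶ iterObj S Y b) :
    iterMap' k S m ha' hb' (iterMap' k S n ha hb f) = iterMap' k S l ha'' hb'' f := by
  obtain rfl : l = n + m := by omega
  subst ha hb
  have key : ∀ {a'' b'' : ℕ} (m : ℕ) (ha' : a'' = a + n + m) (hb' : b'' = b + n + m)
      (ha'' : a'' = a + (n + m)) (hb'' : b'' = b + (n + m)),
      iterMap' k S m ha' hb' (iterMap' k S n rfl rfl f) = iterMap' k S (n + m) ha'' hb'' f := by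
    intro a'' b'' m
    induction m generalizing a'' b'' with
    | zero => rintro rfl rfl _ _; rfl
    | succ m ih =>
      rintro rfl rfl _ _
      exact (iterMap'_succ (a' := a + n + m) (b' := b + n + m) m rfl rfl rfl rfl _).trans
        ((congrArg (fun t => S.map t) (ih rfl rfl (add_assoc _ _ _) (add_assoc _ _ _))).trans
          (iterMap'_succ (n + m) (add_assoc _ _ _) (add_assoc _ _ _) _ _ f).symm)
  exact key m ha' hb' ha'' hb''

lemma colimMk_iterMap' {r : ℤ} {X Y : C} {a b a' b' : ℕ} (h : (a : ℤ) + r = b)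
    (h' : (a' : ℤ) + r = b') (n : ℕ) (ha : a' = a + n) (hb : b' = b + n)
    (f : iterObj S X a ⟶ iterObj S Y b) :
    colimMk h' (iterMap' k S n ha hb f) = colimMk (k := k) h f := by
  have hle : (⟨(a, b), h⟩ : Idx r) ≤ ⟨(a', b'), h'⟩ :=
    ⟨by change a ≤ a'; omega, by change b ≤ b'; omega⟩
  refine Eq.trans ?_ (Module.DirectLimit.of_f (f := transition k S r X Y) (hij := hle) (x := f))
  obtain rfl : n = a' - a := by omega
  rfl

instance (r : ℤ) : Nonempty (Idx r) := ⟨⟨((-r).toNat, r.toNat), by simp only; omega⟩⟩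

instance (r : ℤ) : IsDirectedOrder (Idx r) where
  directed p q := by
    refine ⟨⟨(p.1.1 + q.1.1, p.1.2 + q.1.1), ?_⟩, ⟨?_, ?_⟩, ⟨?_, ?_⟩⟩
    all_goals
      have := p.2
      have := q.2
      push_cast
      omega

lemma exists_colimMk {r : ℤ} {X Y : C} (x : ColimHom k S r X Y) :
    ∃ (a b : ℕ) (h : (a : ℤ) + r = b) (f : iterObj S X a ⟶ iterObj S Y b),
      x = colimMk h f := by
  induction x using Module.DirectLimit.induction_on with
  | ih p f => exact ⟨p.1.1, p.1.2, p.2, f, rfl⟩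

/-- The composition `C_{/S}^r(X, Y) × C_{/S}^s(Y, Z) → C_{/S}^(s+r)(X, Z)`. It sends the classes of
`f : S^a X ⟶ S^b Y` and `g : S^c Y ⟶ S^d Z` to the class of
`(S^b g) ∘ (S^c f) : S^(a+c) X ⟶ S^(b+c) Y = S^(c+b) Y ⟶ S^(d+b) Z`. -/
def colimComp (r s : ℤ) (X Y Z : C) :
    ColimHom k S r X Y →ₗ[k] ColimHom k S s Y Z →ₗ[k] ColimHom k S (s + r) X Z :=
  Module.DirectLimit.lift k (Idx r) _ _
    (fun p => LinearMap.flip <| Module.DirectLimit.lift k (Idx s) _ _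
      (fun q => LinearMap.flip <| LinearMap.mk₂ k
        (fun (f : iterObj S X p.1.1 ⟶ iterObj S Y p.1.2)
            (g : iterObj S Y q.1.1 ⟶ iterObj S Z q.1.2) =>
          colimMk (k := k) (S := S) (r := s + r) (a := p.1.1 + q.1.1) (b := q.1.2 + p.1.2)
            (by have := p.2; have := q.2; push_cast; omega)
            (iterMap' k S (a' := p.1.1 + q.1.1) (b' := p.1.2 + q.1.1) q.1.1 rfl rfl f ≫
              iterMap' k S (a' := p.1.2 + q.1.1) (b' := q.1.2 + p.1.2) p.1.2
                (add_comm _ _) rfl g))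
        (by intros; simp) (by intros; simp) (by intros; simp) (by intros; simp))
      (by
        intro q q' hq g
        ext f
        have h1 := Idx.fst_eq hq
        have h2 := Idx.snd_eq hq
        simp only [LinearMap.flip_apply, LinearMap.mk₂_apply, transition]
        rw [iterMap'_iterMap' _ _ (p.1.2 + (q'.1.1 - q.1.1)) _ _ _ _ (by omega) (by omega)]
        rw [← colimMk_iterMap' (a := p.1.1 + q.1.1) (b := q.1.2 + p.1.2)
          (a' := p.1.1 + q'.1.1) (b' := q'.1.2 + p.1.2)
          (by have := p.2; have := q.2; push_cast; omega)
          (by have := p.2; have := q'.2; push_cast; omega) (q'.1.1 - q.1.1) (by omega) (by omega)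
          (_ ≫ _)]
        rw [iterMap'_comp _ _ (b' := p.1.2 + q'.1.1) (by omega) _,
          iterMap'_iterMap' _ _ q'.1.1 _ _ _ _ rfl rfl,
          iterMap'_iterMap' _ _ (p.1.2 + (q'.1.1 - q.1.1)) _ _ _ _ (by omega) (by omega)]))
    (by
      intro p p' hp f
      ext q g
      have h1 := Idx.fst_eq hp
      have h2 := Idx.snd_eq hp
      simp only [LinearMap.flip_apply, LinearMap.mk₂_apply, transition,
        LinearMap.coe_comp, Function.comp_apply, Module.DirectLimit.lift_of]
      rw [iterMap'_iterMap' _ _ (q.1.1 + (p'.1.1 - p.1.1)) _ _ _ _ (by omega) (by omega)]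
      rw [← colimMk_iterMap' (a := p.1.1 + q.1.1) (b := q.1.2 + p.1.2)
        (a' := p'.1.1 + q.1.1) (b' := q.1.2 + p'.1.2)
        (by have := p.2; have := q.2; push_cast; omega)
        (by have := p'.2; have := q.2; push_cast; omega) (p'.1.1 - p.1.1) (by omega) (by omega)
        (_ ≫ _)]
      rw [iterMap'_comp _ _ (b' := p'.1.2 + q.1.1) (by omega) _,
        iterMap'_iterMap' _ _ (q.1.1 + (p'.1.1 - p.1.1)) _ _ _ _ (by omega) (by omega),
        iterMap'_iterMap' _ _ p'.1.2 _ _ _ _ (by omega) rfl])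

lemma colimComp_mk_mk {r s : ℤ} {X Y Z : C} {a b c d : ℕ} (h : (a : ℤ) + r = b)
    (h' : (c : ℤ) + s = d) (h'' : ((a + c : ℕ) : ℤ) + (s + r) = (d + b : ℕ))
    (f : iterObj S X a ⟶ iterObj S Y b) (g : iterObj S Y c ⟶ iterObj S Z d) :
    colimComp r s X Y Z (colimMk (k := k) h f) (colimMk h' g) =
      colimMk h'' (iterMap' k S (a' := a + c) (b' := b + c) c rfl rfl f ≫
        iterMap' k S (a' := b + c) (b' := d + b) b (add_comm _ _) rfl g) := by
  simp [colimComp, colimMk, Module.DirectLimit.lift_of]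

variable (k S)

/-- `C_{/S}(X, Y) = ⨁_r C_{/S}^r(X, Y)`. -/
abbrev TotalHom (X Y : C) : Type v := DirectSum ℤ fun r => ColimHom k S r X Y

variable {k S}

/-- The composition `(g f)_c = ∑_{c = b + a} g_b f_a`. -/
def totalComp (X Y Z : C) :
    TotalHom k S X Y →ₗ[k] TotalHom k S Y Z →ₗ[k] TotalHom k S X Z :=
  DirectSum.toModule k ℤ _ fun r => LinearMap.flip <| DirectSum.toModule k ℤ _ fun s =>
    LinearMap.flip <|
      (colimComp r s X Y Z).compr₂ (DirectSum.lof k ℤ (fun t => ColimHom k S t X Z) (s + r))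

/-- The element of `C_{/S}(X, Y)` represented by `f : S^a X ⟶ S^b Y`, of degree `b - a`. -/
def gen {X Y : C} {a b : ℕ} (f : iterObj S X a ⟶ iterObj S Y b) : TotalHom k S X Y :=
  DirectSum.lof k ℤ (fun t => ColimHom k S t X Y) ((b : ℤ) - a) (colimMk (add_sub_cancel _ _) f)

lemma lof_colimMk {r : ℤ} {X Y : C} {a b : ℕ} (h : (a : ℤ) + r = b)
    (f : iterObj S X a ⟶ iterObj S Y b) :
    DirectSum.lof k ℤ (fun t => ColimHom k S t X Y) r (colimMk h f) = gen f := by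
  obtain rfl : r = (b : ℤ) - a := by omega
  rfl

lemma gen_iterMap' {X Y : C} {a b a' b' : ℕ} (n : ℕ) (ha : a' = a + n) (hb : b' = b + n)
    (f : iterObj S X a ⟶ iterObj S Y b) :
    gen (iterMap' k S n ha hb f) = gen (k := k) f := by
  rw [← lof_colimMk (r := (b : ℤ) - a) (by omega), colimMk_iterMap' (by omega)]
  rfl

lemma totalComp_lof {r s : ℤ} {X Y Z : C} (x : ColimHom k S r X Y) (y : ColimHom k S s Y Z) :
    totalComp X Y Z (DirectSum.lof k ℤ (fun t => ColimHom k S t X Y) r x)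
      (DirectSum.lof k ℤ (fun t => ColimHom k S t Y Z) s y) =
      DirectSum.lof k ℤ (fun t => ColimHom k S t X Z) (s + r) (colimComp r s X Y Z x y) := by
  simp [totalComp, DirectSum.toModule_lof]

lemma totalComp_gen {X Y Z : C} {a b c : ℕ} (f : iterObj S X a ⟶ iterObj S Y b)
    (g : iterObj S Y b ⟶ iterObj S Z c) :
    totalComp X Y Z (gen (k := k) f) (gen g) = gen (f ≫ g) := by
  rw [gen, gen, totalComp_lof, colimComp_mk_mk _ _ (by push_cast; omega), lof_colimMk,
    ← iterMap'_comp, gen_iterMap']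

lemma total_induction {X Y : C} {P : TotalHom k S X Y → Prop} (x : TotalHom k S X Y)
    (h0 : P 0) (hadd : ∀ x y, P x → P y → P (x + y))
    (hgen : ∀ (a b : ℕ) (f : iterObj S X a ⟶ iterObj S Y b), P (gen f)) : P x := by
  induction x using DirectSum.induction_on with
  | zero => exact h0
  | of r x =>
    obtain ⟨a, b, h, f, rfl⟩ := exists_colimMk x
    have := hgen a b f
    rw [← lof_colimMk h] at this
    exact this
  | add x y hx hy => exact hadd x y hx hy

lemma total_id_comp {X Y : C} (x : TotalHom k S X Y) :
    totalComp X X Y (gen (a := 0) (b := 0) (𝟙 X)) x = x := by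
  induction x using total_induction with
  | h0 => simp
  | hadd x y hx hy => rw [map_add, hx, hy]
  | hgen a b f =>
    have h : gen (k := k) (S := S) (a := 0) (b := 0) (𝟙 X) = gen (𝟙 (iterObj S X a)) := by
      rw [← iterMap'_id (k := k) (a := 0) a (by omega), gen_iterMap']
      rfl
    rw [h, totalComp_gen, Category.id_comp]

lemma total_comp_id {X Y : C} (x : TotalHom k S X Y) :
    totalComp X Y Y x (gen (a := 0) (b := 0) (𝟙 Y)) = x := by
  induction x using total_induction with
  | h0 => simp
  | hadd x y hx hy => rw [map_add, LinearMap.add_apply, hx, hy]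
  | hgen a b f =>
    have h : gen (k := k) (S := S) (a := 0) (b := 0) (𝟙 Y) = gen (𝟙 (iterObj S Y b)) := by
      rw [← iterMap'_id (k := k) (a := 0) b (by omega), gen_iterMap']
      rfl
    rw [h, totalComp_gen, Category.comp_id]

lemma total_assoc {X Y Z W : C} (x : TotalHom k S X Y) (y : TotalHom k S Y Z)
    (z : TotalHom k S Z W) :
    totalComp X Z W (totalComp X Y Z x y) z = totalComp X Y W x (totalComp Y Z W y z) := by
  induction x using total_induction with
  | h0 => simp
  | hadd x x' hx hx' => simp only [map_add, LinearMap.add_apply, hx, hx']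
  | hgen a b f =>
    induction y using total_induction with
    | h0 => simp
    | hadd y y' hy hy' => simp only [map_add, LinearMap.add_apply, hy, hy']
    | hgen c d g =>
      induction z using total_induction with
      | h0 => simp
      | hadd z z' hz hz' => simp only [map_add, hz, hz']
      | hgen e l h =>
        rw [← gen_iterMap' (k := k) (a' := a + (c + e)) (b' := b + c + e) (c + e) (by omega)
            (by omega) f,
          ← gen_iterMap' (k := k) (a' := b + c + e) (b' := b + d + e) (b + e) (by omega)
            (by omega) g,
          ← gen_iterMap' (k := k) (a' := b + d + e) (b' := l + (b + d)) (b + d) (by omega)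
            (by omega) h]
        simp only [totalComp_gen, Category.assoc]

end Colim

/-- The colimit orbit category `C_{/S}` has the same objects as `C`. -/
structure ColimOrbit (k : Type w) [CommRing k] {C : Type u} [Category.{v} C] [Preadditive C]
    [Linear k C] (S : C ⥤ C) where
  obj : C

section ColimOrbit

variable (k : Type w) [CommRing k] {C : Type u} [Category.{v} C] [Preadditive C] [Linear k C]
variable (S : C ⥤ C) [S.Additive] [S.Linear k]

instance : Category (ColimOrbit k S) where
  Hom X Y := TotalHom k S X.obj Y.obj
  id X := gen (a := 0) (b := 0) (𝟙 X.obj)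
  comp f g := totalComp _ _ _ f g
  id_comp f := total_id_comp f
  comp_id f := total_comp_id f
  assoc f g h := total_assoc f g h

instance : Preadditive (ColimOrbit k S) where
  homGroup X Y := inferInstanceAs (AddCommGroup (TotalHom k S X.obj Y.obj))
  add_comp := fun X Y Z (f f' : TotalHom k S X.obj Y.obj) (g : TotalHom k S Y.obj Z.obj) =>
    LinearMap.map_add₂ (totalComp X.obj Y.obj Z.obj) f f' g
  comp_add := fun X Y Z (f : TotalHom k S X.obj Y.obj) (g g' : TotalHom k S Y.obj Z.obj) =>
    map_add (totalComp X.obj Y.obj Z.obj f) g g'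

instance : Linear k (ColimOrbit k S) where
  homModule X Y := inferInstanceAs (Module k (TotalHom k S X.obj Y.obj))
  smul_comp := fun X Y Z r (f : TotalHom k S X.obj Y.obj) (g : TotalHom k S Y.obj Z.obj) =>
    LinearMap.map_smul₂ (totalComp X.obj Y.obj Z.obj) r f g
  comp_smul := fun X Y Z (f : TotalHom k S X.obj Y.obj) r (g : TotalHom k S Y.obj Z.obj) =>
    map_smul (totalComp X.obj Y.obj Z.obj f) r g

/-- The degree `r` component of `C_{/S}(X, Y)`. -/
def colimPiece (r : ℤ) (X Y : ColimOrbit k S) : Submodule k (X ⟶ Y) :=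
  LinearMap.range (DirectSum.lof k ℤ (fun t => ColimHom k S t X.obj Y.obj) r)

lemma directSum_range_lof {M : ℤ → Type v} [∀ r, AddCommGroup (M r)] [∀ r, Module k (M r)] :
    DirectSum.IsInternal fun r => LinearMap.range (DirectSum.lof k ℤ M r) := by
  refine DirectSum.isInternal_submodule_of_iSupIndep_of_iSup_eq_top (fun i => ?_)
    DFinsupp.iSup_range_lsingle
  rw [Submodule.disjoint_def]
  rintro _ ⟨m, rfl⟩ hm
  have hle : ⨆ j ≠ i, LinearMap.range (DirectSum.lof k ℤ M j) ≤
      LinearMap.ker (DirectSum.component k ℤ M i) := by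
    refine iSup₂_le fun j hj => ?_
    rintro _ ⟨m', rfl⟩
    rw [LinearMap.mem_ker, DirectSum.component.of, dif_neg hj]
  have h := hle hm
  rw [LinearMap.mem_ker, DirectSum.component.lof_self] at h
  rw [h, map_zero]

/-- The `ℤ`-grading of `C_{/S}`. -/
instance : ZGraded k (ColimOrbit k S) where
  piece := colimPiece k S
  isInternal X Y := directSum_range_lof k
  id_mem X := ⟨_, lof_colimMk (a := 0) (b := 0) rfl (𝟙 X.obj)⟩
  comp_mem := by
    rintro r s X Y Z _ _ ⟨x, rfl⟩ ⟨y, rfl⟩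
    exact ⟨_, (totalComp_lof x y).symm⟩

lemma gen_zero_mem {X Y : C} (f : X ⟶ Y) (i : ℤ) :
    (gen (k := k) (S := S) (a := 0) (b := 0) f : TotalHom k S X Y) ∈
      ZGraded.piece (k := k) (i - i) (⟨X⟩ : ColimOrbit k S) ⟨Y⟩ :=
  LinearMap.mem_range.2 ⟨_, lof_colimMk (a := 0) (b := 0) (by simp) f⟩

/-- The functor `H : C ⥤ C_{/S} # ℤ`, `X ↦ X^(0)`, `f ↦ [f]`. -/
def toSmash : C ⥤ Smash k (ColimOrbit k S) where
  obj X := ⟨⟨X⟩, 0⟩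
  map f := ⟨gen (a := 0) (b := 0) f, gen_zero_mem k S f 0⟩
  map_id _ := rfl
  map_comp f g := Subtype.ext
    (totalComp_gen (k := k) (S := S) (a := 0) (b := 0) (c := 0) f g).symm

/-- `C/⟨S̄⟩ = (C_{/S} # ℤ)/⟨S'⟩`. -/
abbrev OrbitByAutoEquiv := OrbitByAut (smashShift k (ColimOrbit k S))

end ColimOrbit

end ColimitOrbit

end

noncomputable section

namespace ColimitOrbit

universe w u v

/-! ### The functor `H` and its compatibility with the shifts. -/

section Colim

/-! Since `S` is fully faithful, every transition map of the colimits is bijective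
(`iterMap'_bijective`). So a representative has class zero only if it is zero, and a class of degree
0 has a representative `X ⟶ Y`; this makes `H` fully faithful. An isomorphism `S^a X ≅ S^b Y`
becomes an isomorphism `X^(i) ≅ Y^(j)` whenever `i - j = b - a` (`smashIso`), so objects of any
degree can be moved to degree 0, and `H` is essentially surjective. The identities `S^0 (S X) ⟶ S^1
X` give `H ∘ S ≅ S' ∘ H` in the same way.

Part 3 is a fact about any `ℤ`-graded category `B`: forgetting degrees induces an equivalence `(B #
ℤ)/G ≌ B` if `G` acts over `B` and simply transitively on degrees by translations
(`IsTranslationAction`). An invariant matrix is determined by its column at `1`. The entries of that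
column are morphisms of `B` in pairwise distinct degrees, and every degree occurs, so the column is
the family of homogeneous components of one morphism of `B`. Its sum recovers that morphism
(`orbitForgetMap_injective`, `orbitForgetMap_surjective`). -/

lemma exists_iterObj_iso {C : Type u} [Category.{v} C] (S : C ⥤ C) [S.IsEquivalence]
    (X : C) (n : ℕ) :
    ∃ Y : C, Nonempty (X ≅ iterObj S Y n) := by
  induction n generalizing X with
  | zero => exact ⟨X, ⟨Iso.refl X⟩⟩
  | succ n ih =>
    obtain ⟨Y, ⟨e⟩⟩ := ih (S.objPreimage X)
    exact ⟨Y, ⟨(S.objObjPreimageIso X).symm ≪≫ S.mapIso e⟩⟩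

variable {k : Type w} [CommRing k] {C : Type u} [Category.{v} C] [Preadditive C] [Linear k C]
variable {S : C ⥤ C} [S.Additive] [S.Linear k]

/-- An iterate of the fully faithful functor `S` is fully faithful. -/
lemma iterMap'_bijective [S.IsEquivalence] {X Y : C} {a b a' b' : ℕ} (n : ℕ) (ha : a' = a + n)
    (hb : b' = b + n) : Function.Bijective (iterMap' k S (X := X) (Y := Y) n ha hb) := by
  subst ha hb
  change Function.Bijective (iterMap k S X Y a b n)
  induction n with
  | zero => exact Function.bijective_id
  | succ n ih =>
    have h : Function.Bijective (fun f : iterObj S X (a + n) ⟶ iterObj S Y (b + n) => S.map f) :=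
      ⟨S.map_injective, S.map_surjective⟩
    exact h.comp ih

/-- Needed to know that elements with the same class in the direct limit already agree at a later
stage. -/
instance (r : ℤ) (X Y : C) :
    DirectedSystem (fun p : Idx r => (iterObj S X p.1.1 ⟶ iterObj S Y p.1.2))
      fun p q h => transition k S r X Y p q h where
  map_self p f := by
    obtain ⟨⟨a, b⟩, hab⟩ := p
    -- The exponent `a - a` is not definitionally `0`, so `f` is read as `S^0 f` and the two
    -- exponents are added.
    exact (iterMap'_iterMap' (k := k) 0 (a - a) 0 rfl rfl (by simp) (by simp) rfl rfl f :)
  map_map p q l hpq hql f :=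
    iterMap'_iterMap' _ _ _ _ _ _ _ (Idx.fst_eq (hpq.trans hql)) (Idx.snd_eq (hpq.trans hql)) f

lemma colimMk_eq_zero_iff [S.IsEquivalence] {r : ℤ} {X Y : C} {a b : ℕ} (h : (a : ℤ) + r = b)
    (f : iterObj S X a ⟶ iterObj S Y b) : colimMk (k := k) h f = 0 ↔ f = 0 := by
  refine ⟨fun h0 => ?_, fun h0 => by rw [h0, map_zero]⟩
  obtain ⟨q, hq, h1⟩ := Module.DirectLimit.exists_eq_of_of_eq
    (f := transition k S r X Y) (i := ⟨(a, b), h⟩) (x := f) (y := 0)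
    (h0.trans (map_zero (colimMk h)).symm)
  exact (iterMap'_bijective (k := k) _ _ _).1 h1

lemma gen_eq_zero_iff [S.IsEquivalence] {X Y : C} {a b : ℕ}
    (f : iterObj S X a ⟶ iterObj S Y b) : gen (k := k) f = 0 ↔ f = 0 := by
  refine Iff.trans ?_ (colimMk_eq_zero_iff (k := k) (add_sub_cancel (a : ℤ) b) f)
  exact (map_eq_zero_iff _ (DirectSum.of_injective _))

variable (k S)

lemma gen_add {X Y : C} {a b : ℕ} (f g : iterObj S X a ⟶ iterObj S Y b) :
    gen (k := k) (f + g) = gen f + gen g := by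
  simp [gen]

lemma gen_smul {X Y : C} {a b : ℕ} (c : k) (f : iterObj S X a ⟶ iterObj S Y b) :
    gen (k := k) (c • f) = c • gen f := by
  simp [gen]

instance : (toSmash k S).Additive where
  map_add {_ _ f g} := Subtype.ext (gen_add k S (a := 0) (b := 0) f g)

instance : (toSmash k S).Linear k where
  map_smul f c := Subtype.ext (gen_smul k S (a := 0) (b := 0) c f)

instance [S.IsEquivalence] : (toSmash k S).Faithful where
  map_injective {X Y f g} h := by
    rw [← sub_eq_zero] at h ⊢
    rw [← Functor.map_sub] at h
    exact (gen_eq_zero_iff (k := k) (S := S) (a := 0) (b := 0) (f - g)).1 (congrArg Subtype.val h)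

instance [S.IsEquivalence] : (toSmash k S).Full where
  map_surjective {X Y} := by
    rintro ⟨_, x, rfl⟩
    obtain ⟨a, b, h, f, rfl⟩ := exists_colimMk x
    change (a : ℤ) + (0 - 0) = b at h
    -- A class of degree `0 - 0` is represented by some `S^b X ⟶ S^b Y`, which is `S^b` of a
    -- morphism `X ⟶ Y` with the same class.
    obtain rfl : b = a := by omega
    obtain ⟨f, rfl⟩ := (iterMap'_bijective (k := k) (a := 0) (b := 0) b (by simp) (by simp)).2 f
    refine ⟨f, Subtype.ext ?_⟩
    exact (gen_iterMap' (k := k) b _ _ f).symm.trans (lof_colimMk _ _).symm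

/-- The class of an isomorphism `S^a X ≅ S^b Y`, as an isomorphism `X^(i) ≅ Y^(j)` of
`C_{/S} # ℤ`, where `i - j = b - a`. -/
def smashIso {X Y : C} {i j : ℤ} {a b : ℕ} (h : (a : ℤ) + (i - j) = b)
    (e : iterObj S X a ≅ iterObj S Y b) :
    (⟨⟨X⟩, i⟩ : Smash k (ColimOrbit k S)) ≅ ⟨⟨Y⟩, j⟩ where
  hom := ⟨gen e.hom, LinearMap.mem_range.2 ⟨_, lof_colimMk h e.hom⟩⟩
  inv := ⟨gen e.inv, LinearMap.mem_range.2
    ⟨_, lof_colimMk (show (b : ℤ) + (j - i) = a by omega) e.inv⟩⟩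
  hom_inv_id := Subtype.ext <| (totalComp_gen e.hom e.inv).trans <| by
    -- The identity of the smash product is the class of `𝟙` at level 0, hence also that of `𝟙 = S^a
    -- 𝟙` at level `a`.
    rw [e.hom_inv_id, ← iterMap'_id (k := k) (a := 0) a (by omega), gen_iterMap']
    rfl
  inv_hom_id := Subtype.ext <| (totalComp_gen e.inv e.hom).trans <| by
    rw [e.inv_hom_id, ← iterMap'_id (k := k) (a := 0) b (by omega), gen_iterMap']
    rfl

instance [S.IsEquivalence] : (toSmash k S).EssSurj where
  mem_essImage := by
    rintro ⟨⟨X⟩, i⟩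
    obtain ⟨n, rfl | rfl⟩ := i.eq_nat_or_neg
    -- In degree `n ≥ 0`, `X` must be divided by `S^n`, which uses essential surjectivity of `S`; in
    -- degree `-n` the object `S^n X` serves.
    · obtain ⟨Y, ⟨e⟩⟩ := exists_iterObj_iso S X n
      exact ⟨Y, ⟨(smashIso k S (a := 0) (b := n) (i := n) (j := 0) (by simp) e).symm⟩⟩
    · exact ⟨iterObj S X n, ⟨(smashIso k S (a := n) (b := 0) (i := -n) (j := 0) (by simp)
        (Iso.refl (iterObj S X n))).symm⟩⟩

instance [S.IsEquivalence] : (toSmash k S).IsEquivalence where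

/-- The natural isomorphism `H ∘ S ≅ S' ∘ H`, given by the classes of the identities
`S^0 (S X) ⟶ S^1 X`. -/
def toSmashShiftIso :
    S ⋙ toSmash k S ≅ toSmash k S ⋙ (smashShift k (ColimOrbit k S)).functor :=
  NatIso.ofComponents
    (fun X => smashIso k S (X := S.obj X) (Y := X) (a := 0) (b := 1) (i := 0) (j := 0 + -1)
      (by simp) (Iso.refl (S.obj X)))
    fun {X Y} f => Subtype.ext <| by
      refine (totalComp_gen (k := k) (S := S) (X := S.obj X) (Y := S.obj Y) (Z := Y)
        (a := 0) (b := 0) (c := 1) (S.map f) (𝟙 (S.obj Y))).trans ?_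
      -- `[f]` is replaced by `[S f]`, whose representative starts at `S^1 X`, the target of `𝟙 :
      -- S^0 (S X) ⟶ S^1 X`. Both sides of the naturality square are then the class of `S f`.
      refine Eq.trans ?_ (congrArg (totalComp (k := k) (S := S) (S.obj X) X Y
        (gen (a := 0) (b := 1) (𝟙 (S.obj X))))
        (gen_iterMap' (k := k) (S := S) (a := 0) (b := 0) (a' := 1) (b' := 1) 1 rfl rfl f))
      refine Eq.trans ?_ (totalComp_gen (k := k) (S := S) (X := S.obj X) (Y := X) (Z := Y)
        (a := 0) (b := 1) (c := 1) (𝟙 (S.obj X)) (S.map f)).symm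
      exact congrArg (gen (k := k) (S := S) (X := S.obj X) (Y := Y) (a := 0) (b := 1))
        ((Category.comp_id (S.map f)).trans (Category.id_comp (S.map f)).symm)

end Colim

/-! ### Forgetting degrees on a smash product. -/

section SmashOrbit

variable (k : Type w) [CommRing k] (B : Type u) [Category.{v} B] [Preadditive B]
  [Linear k B] [ZGraded k B]

/-- The forgetful functor `B # ℤ ⥤ B`, `x^(i) ↦ x`. -/
def smashForget : Smash k B ⥤ B where
  obj x := x.obj
  map f := f.1
  map_id _ := rfl
  map_comp _ _ := rfl

instance : (smashForget k B).Additive where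
  map_add := rfl

instance : (smashForget k B).Linear k where
  map_smul _ _ := rfl

/-- The automorphisms of `B # ℤ` over `B`. -/
def autOverForget : Subgroup (LinAut k (Smash k B)) where
  carrier := {α | α.functor ⋙ smashForget k B = smashForget k B}
  mul_mem' {α β} hα hβ :=
    (congrArg (fun F => β.functor ⋙ F) (hα : α.functor ⋙ smashForget k B = _)).trans hβ
  one_mem' := rfl
  inv_mem' {α} hα :=
    (congrArg (fun F => α.inverse ⋙ F) (hα : α.functor ⋙ smashForget k B = _)).symm.trans
      (congrArg (fun F => F ⋙ smashForget k B) α.inverse_functor)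

variable {k B}

/-- Graded pieces with distinct degrees are independent. -/
lemma eq_zero_of_sum_mem_piece {x y : B} {ι : Type*} (s : Finset ι) (d : ι → ℤ)
    (hd : Function.Injective d) (f : ι → (x ⟶ y))
    (hf : ∀ i, f i ∈ ZGraded.piece (k := k) (d i) x y) (h : ∑ i ∈ s, f i = 0) :
    ∀ i ∈ s, f i = 0 := by
  have hind := ((ZGraded.isInternal (k := k) x y).submodule_iSupIndep.comp hd)
  exact fun i hi => (iSupIndep_iff_finsetSum_eq_zero_imp_eq_zero _).1 hind s f
    (fun i _ => hf i) h i hi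

/-- An action over `B` fixes underlying objects only up to propositional equality; the resulting
`eqToHom`s do not affect degrees. -/
lemma eqToHom_comp_comp_mem {x y x' y' : B} (hx : x' = x) (hy : y = y') (r : ℤ) (f : x ⟶ y) :
    eqToHom hx ≫ f ≫ eqToHom hy ∈ ZGraded.piece (k := k) r x' y' ↔
      f ∈ ZGraded.piece (k := k) r x y := by
  subst hx hy
  simp

/-! ### Orbit categories of smash products under translation actions. -/

variable {G : Type*} [Group G]

/-- An action of a group `G` on `B # ℤ` over `B`, which acts on the degrees of the objects over any
object of `B` by translations, simply transitively. -/
structure IsTranslationAction (ρ : G →* LinAut k (Smash k B)) : Prop where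
  comp_forget : ∀ α, (ρ α).functor ⋙ smashForget k B = smashForget k B
  deg_sub_deg : ∀ (α : G) (x y : Smash k B),
    ((ρ α).functor.obj x).deg - ((ρ α).functor.obj y).deg = x.deg - y.deg
  deg_bijective : ∀ x, Function.Bijective fun α => ((ρ α).functor.obj x).deg

namespace IsTranslationAction

variable {ρ : G →* LinAut k (Smash k B)} (h : IsTranslationAction ρ)

include h

lemma obj_eq (α : G) (x : Smash k B) :
    (smashForget k B).obj ((ρ α).functor.obj x) = (smashForget k B).obj x :=
  Functor.congr_obj (h.comp_forget α) x

lemma deg_mul_sub_deg_mul (γ α β : G) (x y : Smash k B) :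
    ((ρ (γ * α)).functor.obj x).deg - ((ρ (γ * β)).functor.obj y).deg =
      ((ρ α).functor.obj x).deg - ((ρ β).functor.obj y).deg := by
  rw [act_mul_obj, act_mul_obj, h.deg_sub_deg]

/-- The morphism of `B` underlying a morphism `α x ⟶ β y`. -/
def underlying {x y : Smash k B} (β α : G) :
    ((ρ α).functor.obj x ⟶ (ρ β).functor.obj y) →ₗ[k]
      ((smashForget k B).obj x ⟶ (smashForget k B).obj y) where
  toFun f := eqToHom (h.obj_eq α x).symm ≫ (smashForget k B).map f ≫ eqToHom (h.obj_eq β y)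
  map_add' := by simp [Functor.map_add]
  map_smul' := by simp [Functor.map_smul]

lemma underlying_apply {x y : Smash k B} (β α : G)
    (f : (ρ α).functor.obj x ⟶ (ρ β).functor.obj y) :
    h.underlying β α f = eqToHom (h.obj_eq α x).symm ≫ (smashForget k B).map f ≫
      eqToHom (h.obj_eq β y) := rfl

/-- Together with `underlying_injective` and `exists_underlying`, this identifies the morphisms `α x
⟶ β y` with one graded piece of `B`. -/
lemma underlying_mem {x y : Smash k B} (β α : G)
    (f : (ρ α).functor.obj x ⟶ (ρ β).functor.obj y) :
    h.underlying β α f ∈ ZGraded.piece (k := k)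
      (((ρ α).functor.obj x).deg - ((ρ β).functor.obj y).deg)
      ((smashForget k B).obj x) ((smashForget k B).obj y) :=
  (eqToHom_comp_comp_mem _ _ _ _).2 f.2

lemma underlying_injective {x y : Smash k B} (β α : G) :
    Function.Injective (h.underlying (x := x) (y := y) β α) := by
  intro f g hfg
  rw [underlying_apply, underlying_apply, cancel_epi] at hfg
  exact Subtype.ext ((cancel_mono (eqToHom (h.obj_eq β y))).1 hfg)

lemma exists_underlying {x y : Smash k B} (β α : G)
    (b : (smashForget k B).obj x ⟶ (smashForget k B).obj y)
    (hb : b ∈ ZGraded.piece (k := k)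
      (((ρ α).functor.obj x).deg - ((ρ β).functor.obj y).deg)
      ((smashForget k B).obj x) ((smashForget k B).obj y)) :
    ∃ f : (ρ α).functor.obj x ⟶ (ρ β).functor.obj y, h.underlying β α f = b := by
  refine ⟨⟨eqToHom (h.obj_eq α x) ≫ b ≫ eqToHom (h.obj_eq β y).symm,
    (eqToHom_comp_comp_mem _ _ _ _).2 hb⟩, ?_⟩
  rw [underlying_apply]
  change eqToHom _ ≫ (eqToHom _ ≫ b ≫ eqToHom _) ≫ eqToHom _ = b
  simp

/-- `γ` acts over `B`, so it moves the end points but not the morphism of `B`. -/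
lemma underlying_actMap {x y : Smash k B} (γ β α : G)
    (f : (ρ α).functor.obj x ⟶ (ρ β).functor.obj y) :
    h.underlying (γ * β) (γ * α) (actMap ρ γ f) = h.underlying β α f := by
  have h' := Functor.congr_hom (h.comp_forget γ) f
  rw [Functor.comp_map] at h'
  simp [underlying_apply, actMap, h', eqToHom_map]

lemma underlying_comp {x y z : Smash k B} (γ β α : G)
    (f : (ρ α).functor.obj x ⟶ (ρ β).functor.obj y)
    (g : (ρ β).functor.obj y ⟶ (ρ γ).functor.obj z) :
    h.underlying γ α (f ≫ g) = h.underlying β α f ≫ h.underlying γ β g := by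
  simp [underlying_apply]

lemma underlying_id (x : Smash k B) (α : G) :
    h.underlying α α (𝟙 ((ρ α).functor.obj x)) = 𝟙 ((smashForget k B).obj x) := by
  simp [underlying_apply]

/-- The action on morphisms of the forgetful functor `(B # ℤ)/G ⥤ B`: it sends a matrix `f` to the
sum of the morphisms of `B` underlying the entries `f β 1 : x ⟶ β y`. -/
def orbitForgetMap {x y : Smash k B} :
    orbitHom ρ x y →ₗ[k]
      ((smashForget k B).obj x ⟶ (smashForget k B).obj y) where
  toFun f := ∑ᶠ β, h.underlying β 1 (f.1 β 1)
  map_add' f g := by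
    rw [← finsum_add_distrib]
    · exact finsum_congr fun β => map_add (h.underlying β 1) (f.1 β 1) (g.1 β 1)
    · exact (f.2.1 1).subset fun β hβ h0 => hβ (by simp [h0])
    · exact (g.2.1 1).subset fun β hβ h0 => hβ (by simp [h0])
  map_smul' c f := by
    rw [RingHom.id_apply, smul_finsum']
    · exact finsum_congr fun β => map_smul (h.underlying β 1) c (f.1 β 1)
    · exact (f.2.1 1).subset fun β hβ h0 => hβ (by simp [h0])

lemma orbitForgetMap_eq_sum {x y : Smash k B} (f : orbitHom ρ x y)
    (s : Finset G) (hs : ∀ β, f.1 β 1 ≠ 0 → β ∈ s) :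
    h.orbitForgetMap f = ∑ β ∈ s, h.underlying β 1 (f.1 β 1) :=
  finsum_eq_sum_of_support_subset _ fun β hβ => hs β fun h0 => hβ (by simp [h0])

/-- By invariance, the morphism underlying the entry `f β α` depends only on `α⁻¹ * β`, so the
column at `1` determines the matrix. -/
lemma underlying_apply_mul {x y : Smash k B} (f : orbitHom ρ x y) (γ β : G) :
    h.underlying (γ * β) γ (f.1 (γ * β) γ) = h.underlying β 1 (f.1 β 1) := by
  rw [← h.underlying_actMap γ β 1, ← f.2.2.2]
  congr! <;> simp

/-- The sum of the underlying morphisms of the entries of any column. -/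
lemma finsum_underlying_column {x y : Smash k B} (f : orbitHom ρ x y) (α : G) :
    ∑ᶠ β, h.underlying β α (f.1 β α) = h.orbitForgetMap f := by
  rw [← finsum_comp_equiv (Equiv.mulLeft α)]
  exact finsum_congr fun β => h.underlying_apply_mul f α β

/-- The left side is a double sum over `β` and `γ` of the terms `g β γ ∘ f γ 1`. Summing over `β`
first gives the sum of column `γ` of `g`, which does not depend on `γ`, so it factors out. -/
lemma orbitForgetMap_comp {x y z : Smash k B} (f : orbitHom ρ x y) (g : orbitHom ρ y z) :
    h.orbitForgetMap ⟨orbitCompFun _ f.1 g.1, orbitCompFun_mem _ f g⟩ =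
      h.orbitForgetMap f ≫ h.orbitForgetMap g := by
  have h1 : ∀ β, h.underlying β 1 (orbitCompFun _ f.1 g.1 β 1) =
      ∑ γ ∈ (f.2.1 1).toFinset, h.underlying γ 1 (f.1 γ 1) ≫ h.underlying β γ (g.1 β γ) := by
    intro β
    rw [orbitCompFun_col _ β 1 (f.2.1 1).toFinset (by simp), map_sum]
    exact Finset.sum_congr rfl fun γ _ => h.underlying_comp _ _ _ _ _
  have h2 : ∀ γ, (Function.support fun β => h.underlying β γ (g.1 β γ)).Finite := fun γ =>
    (g.2.1 γ).subset fun β hβ h0 => hβ (by simp [h0])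
  refine (finsum_congr h1).trans ?_
  rw [finsum_sum_comm, h.orbitForgetMap_eq_sum f (f.2.1 1).toFinset (by simp),
    Preadditive.sum_comp]
  · refine Finset.sum_congr rfl fun γ _ => ?_
    rw [← h.finsum_underlying_column g γ]
    exact ((Preadditive.leftComp _ (h.underlying γ 1 (f.1 γ 1))).map_finsum (h2 γ)).symm
  · exact fun γ _ => (h2 γ).subset fun β hβ h0 => hβ (by simp only [h0, Limits.comp_zero])

/-- The entries `f β 1` lie in degrees that are distinct for distinct `β`, because `β ↦ deg (β y)`
is injective. If they sum to zero, each vanishes, and invariance carries this to the other columns.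
-/
lemma orbitForgetMap_injective {x y : Smash k B} :
    Function.Injective (h.orbitForgetMap (x := x) (y := y)) := by
  rw [injective_iff_map_eq_zero]
  intro f hf
  rw [h.orbitForgetMap_eq_sum f (f.2.1 1).toFinset (by simp)] at hf
  have h0 := eq_zero_of_sum_mem_piece _ _
    (fun β γ hβγ => (h.deg_bijective y).1 (sub_right_injective hβγ)) _
    (fun β => h.underlying_mem β 1 (f.1 β 1)) hf
  have h1 : ∀ β, f.1 β 1 = 0 := fun β => by
    by_contra hβ
    exact hβ (h.underlying_injective β 1 ((h0 β (by simpa using hβ)).trans (map_zero _).symm))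
  refine Subtype.ext (funext fun β => funext fun α => ?_)
  refine h.underlying_injective β α ?_
  have := h.underlying_apply_mul f α (α⁻¹ * β)
  rw [mul_inv_cancel_left, h1, map_zero] at this
  exact this.trans (map_zero _).symm

/-- The range is a submodule, so a homogeneous `b` of degree `r` suffices. It is the image of the
matrix with entry `b` wherever `α x ⟶ β y` has degree `r`, and `0` elsewhere. Each row and column
has at most one such position, and translations preserve the set of these positions. -/
lemma orbitForgetMap_surjective {x y : Smash k B} :
    Function.Surjective (h.orbitForgetMap (x := x) (y := y)) := by
  classical
  suffices hs : LinearMap.range (h.orbitForgetMap (x := x) (y := y)) = ⊤ from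
    LinearMap.range_eq_top.1 hs
  rw [eq_top_iff, ← (ZGraded.isInternal (k := k) ((smashForget k B).obj x)
    ((smashForget k B).obj y)).submodule_iSup_eq_top, iSup_le_iff]
  intro r b hb
  have hF : ∀ β α : G, ∃ f : (ρ α).functor.obj x ⟶ (ρ β).functor.obj y, h.underlying β α f =
      if ((ρ α).functor.obj x).deg - ((ρ β).functor.obj y).deg = r then b else 0 := by
    intro β α
    refine h.exists_underlying β α _ ?_
    split_ifs with hr
    · rwa [hr]
    · exact zero_mem _
  choose F hF using hF
  have hF0 : ∀ β α, F β α ≠ 0 →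
      ((ρ α).functor.obj x).deg - ((ρ β).functor.obj y).deg = r := by
    intro β α h0
    by_contra hr
    refine h0 (h.underlying_injective β α ?_)
    rw [hF, if_neg hr, map_zero]
  have hmem : F ∈ orbitHom ρ x y := by
    refine ⟨fun α => Set.Subsingleton.finite fun β hβ γ hγ => (h.deg_bijective y).1 ?_,
      fun β => Set.Subsingleton.finite fun α hα γ hγ => (h.deg_bijective x).1 ?_,
      fun γ β α => h.underlying_injective _ _ ?_⟩
    · exact sub_right_injective ((hF0 β α hβ).trans (hF0 γ α hγ).symm)
    · exact sub_left_injective ((hF0 β α hα).trans (hF0 β γ hγ).symm)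
    · rw [h.underlying_actMap, hF, hF, h.deg_mul_sub_deg_mul]
  -- This `β` is the only row where the column at `1` can be nonzero; it exists by transitivity on
  -- degrees.
  obtain ⟨β, hβ⟩ := (h.deg_bijective y).2 (((ρ 1).functor.obj x).deg - r)
  refine ⟨⟨F, hmem⟩, ?_⟩
  rw [h.orbitForgetMap_eq_sum _ {β} fun γ hγ => ?_, Finset.sum_singleton]
  · exact (hF β 1).trans (if_pos (by simp only at hβ; omega))
  · have := hF0 γ 1 hγ
    exact Finset.mem_singleton.2 ((h.deg_bijective y).1 (by simp only at hβ ⊢; omega))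

/-- The forgetful functor `(B # ℤ)/G ⥤ B`, `x^(i) ↦ x`. -/
def orbitForget : OrbitCat ρ ⥤ B where
  obj x := x.obj.obj
  map f := h.orbitForgetMap f
  map_id x := by
    refine (h.orbitForgetMap_eq_sum (orbitId ρ x.obj) {1} fun β hβ => ?_).trans ?_
    · by_contra h0
      exact hβ (orbitId_ne _ _ _ _ fun e => h0 (by simp [e]))
    · rw [Finset.sum_singleton, orbitId_same]
      exact h.underlying_id _ _
  map_comp f g := h.orbitForgetMap_comp f g

lemma orbitForget_additive : h.orbitForget.Additive where
  map_add {_ _ f g} := map_add h.orbitForgetMap f g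

lemma orbitForget_linear : h.orbitForget.Linear k where
  map_smul f c := map_smul h.orbitForgetMap c f

lemma orbitForget_isEquivalence : h.orbitForget.IsEquivalence where
  faithful := ⟨fun hfg => h.orbitForgetMap_injective hfg⟩
  full := ⟨fun f => h.orbitForgetMap_surjective f⟩
  essSurj := ⟨fun x => ⟨⟨⟨x, 0⟩⟩, ⟨Iso.refl x⟩⟩⟩

end IsTranslationAction

/-! ### The cyclic group generated by `S'` as a translation action. -/

lemma smashShift_zpow_deg (n : ℤ) (x : Smash k B) :
    ((smashShift k B ^ n).functor.obj x).deg = x.deg - n := by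
  induction n generalizing x with
  | zero => exact (sub_zero _).symm
  | succ n ih =>
    rw [zpow_add_one]
    refine (ih ((smashShift k B).functor.obj x)).trans ?_
    change x.deg + -1 - _ = _
    ring
  | pred n ih =>
    rw [zpow_sub_one]
    refine (ih ((smashShift k B).inverse.obj x)).trans ?_
    change x.deg + 1 - _ = _
    ring

variable (k B) in
/-- The action of `⟨S'⟩` on `B # ℤ`. -/
lemma isTranslationAction_zpowers_smashShift :
    IsTranslationAction (Subgroup.zpowers (smashShift k B)).subtype where
  comp_forget α :=
    -- Automorphisms over `B` form a subgroup, so only the generator `S'` has to be checked.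
    (Subgroup.zpowers_le.2 (show smashShift k B ∈ autOverForget k B from rfl)) α.2
  deg_sub_deg := by
    rintro ⟨_, n, rfl⟩ x y
    exact (congrArg₂ (· - ·) (smashShift_zpow_deg n x) (smashShift_zpow_deg n y)).trans
      (sub_sub_sub_cancel_right _ _ _)
  deg_bijective x := by
    constructor
    · rintro ⟨_, m, rfl⟩ ⟨_, n, rfl⟩ hmn
      obtain rfl : m = n := sub_right_injective
        ((smashShift_zpow_deg m x).symm.trans (hmn.trans (smashShift_zpow_deg n x)))
      rfl
    -- `S'^n` lowers degrees by `n`, so the exponent `x.deg - r` brings `x` to degree `r`.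
    · exact fun r => ⟨⟨_, x.deg - r, rfl⟩, (smashShift_zpow_deg _ x).trans (sub_sub_cancel _ _)⟩

end SmashOrbit

end ColimitOrbit

end

open CategoryTheory ColimitOrbit in
theorem mainTheorem10 {k : Type*} [CommRing k] {C : Type*} [Category C] [Preadditive C]
    [Linear k C] (S : C ⥤ C) [S.Additive] [S.Linear k] [S.IsEquivalence] :
    ((toSmash k S).IsEquivalence ∧ (toSmash k S).Additive ∧ (toSmash k S).Linear k) ∧
    Nonempty (S ⋙ toSmash k S ≅ toSmash k S ⋙ (smashShift k (ColimOrbit k S)).functor) ∧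
    ∃ E : OrbitByAutoEquiv k S ⥤ ColimOrbit k S, E.IsEquivalence ∧ E.Additive ∧ E.Linear k :=
  have h := isTranslationAction_zpowers_smashShift k (ColimOrbit k S)
  ⟨⟨inferInstance, inferInstance, inferInstance⟩, ⟨toSmashShiftIso k S⟩, h.orbitForget,
    h.orbitForget_isEquivalence, h.orbitForget_additive, h.orbitForget_linear⟩
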